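/- Let $n$ be a natural number and let $C(n)$ be the set of all compact convex sets $V\subset\mathbb R^n$ with nonempty interior that are symmetric about the origin, equipped with the Hausdorff metric. For $V\in C(n)$, the Löwner ellipsoid of $V$ is the ellipsoid of minimal Euclidean volume among all ellipsoids centred at $0$ (images $T(B^n)$ of the closed Euclidean unit ball $B^n$ under $T\in GL(n)$) that contain $V$. Let $L(n)\subset C(n)$ be the subspace of all $V\in C(n)$ whose Löwner ellipsoid is $B^n$. The orthogonal group $O(n)$ acts on $L(n)$ by $g\cdot V=g(V)$. A convex set $V\subset\mathbb R^n$ is called elliptically convex if the set of its extreme points equals its relative boundary, and non-elliptically convex otherwise. **Theorem.** There exists an $O(n)$-homotopy $F:L(n)\times[0,1]\to L(n)$, i.e. a continuous map, with $F_t(V)=F(V,t)$, satisfying $F_t(g\cdot V)=g\cdot F_t(V)$ for all $g\in O(n)$, $V\in L(n)$, $t\in[0,1]$, such that 1. $F_0=\mathrm{Id}_{L(n)}$; and 2. $F_t(V)$ is non-elliptically convex for every $V\in L(n)$ with $V\neq B^n$ and every $t\in(0,1]$. (For $n\le 1$ one has $L(n)=\{B^n\}$ and condition 2 is vacuous.)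 -/

import Mathlib

open MeasureTheory Set Metric

noncomputable section

/-- `ℝⁿ` with its Euclidean norm. -/
abbrev Rn (n : ℕ) : Type := EuclideanSpace ℝ (Fin n)

/-- The orthogonal group `O(n)`, as the group of linear isometries of `ℝⁿ` (under composition). -/
abbrev On (n : ℕ) : Type := Rn n ≃ₗᵢ[ℝ] Rn n

/-- The space `C(n)` of compact convex subsets of `ℝⁿ` with nonempty interior that are symmetric
about `0`. As a subtype of `ConvexBody (Rn n)` it carries the Hausdorff metric. -/
abbrev SymBody (n : ℕ) : Type :=
  {V : ConvexBody (Rn n) // (∀ x ∈ V, -x ∈ V) ∧ (interior (V : Set (Rn n))).Nonempty}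

/-- The underlying subset of `ℝⁿ` of an element of `C(n)`. -/
def SymBody.toSet {n : ℕ} (V : SymBody n) : Set (Rn n) := (V.1 : Set (Rn n))

/-- The ellipsoids centred at `0`: the images of the closed unit ball under invertible linear
maps. -/
def IsEllipsoid {n : ℕ} (E : Set (Rn n)) : Prop :=
  ∃ T : Rn n ≃L[ℝ] Rn n, E = T '' closedBall (0 : Rn n) 1

/-- `E` is a Löwner ellipsoid of `V`: an ellipsoid centred at `0` that contains `V`, of minimal
Euclidean volume among all of these. -/
structure IsLownerEllipsoid {n : ℕ} (E V : Set (Rn n)) : Prop where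
  isEllipsoid : IsEllipsoid E
  subset : V ⊆ E
  volume_le : ∀ E' : Set (Rn n), IsEllipsoid E' → V ⊆ E' → volume E ≤ volume E'

/-- The space `L(n)` of those `V` in `C(n)` whose Löwner ellipsoid is the closed unit ball `Bⁿ`,
with the Hausdorff metric. -/
abbrev LownerSlice (n : ℕ) : Type :=
  {V : SymBody n // IsLownerEllipsoid (closedBall (0 : Rn n) 1) V.toSet}

/-- The underlying subset of `ℝⁿ` of an element of `L(n)`. -/
def LownerSlice.toSet {n : ℕ} (V : LownerSlice n) : Set (Rn n) := V.1.toSet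

/-- `V` is elliptically convex: its extreme points are exactly the points of its relative
boundary. -/
def IsEllipticallyConvex {n : ℕ} (V : Set (Rn n)) : Prop :=
  V.extremePoints ℝ = intrinsicFrontier ℝ V

/-- The image `g(V)` of an element of `C(n)` under an orthogonal map. -/
def SymBody.map {n : ℕ} (g : On n) (V : SymBody n) : SymBody n :=
  ⟨⟨g '' V.toSet, V.1.convex.is_linear_image g.toLinearEquiv.toLinearMap.isLinear,
    V.1.isCompact.image g.continuous, V.1.nonempty.image g⟩, by
    constructor
    · rintro _ ⟨x, hx, rfl⟩
      exact ⟨-x, V.2.1 x hx, map_neg g x⟩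
    · change (interior (g.toHomeomorph '' V.toSet)).Nonempty
      rw [← g.toHomeomorph.image_interior]
      exact V.2.2.image _⟩

theorem SymBody.toSet_map {n : ℕ} (g : On n) (V : SymBody n) :
    (SymBody.map g V).toSet = g '' V.toSet := rfl

theorem SymBody.ext_toSet {n : ℕ} {V W : SymBody n} (h : V.toSet = W.toSet) : V = W :=
  Subtype.ext (ConvexBody.ext h)

theorem isEllipsoid_image {n : ℕ} (g : On n) {E : Set (Rn n)} (h : IsEllipsoid E) :
    IsEllipsoid (g '' E) := by
  obtain ⟨T, rfl⟩ := h
  exact ⟨T.trans g.toContinuousLinearEquiv, by rw [image_image]; rfl⟩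

theorem isLownerEllipsoid_image {n : ℕ} (g : On n) {V : Set (Rn n)}
    (h : IsLownerEllipsoid (closedBall (0 : Rn n) 1) V) :
    IsLownerEllipsoid (closedBall (0 : Rn n) 1) (g '' V) where
  isEllipsoid := h.isEllipsoid
  subset := by
    rintro _ ⟨x, hx, rfl⟩
    have := h.subset hx
    simpa using this
  volume_le := by
    intro E' hE' hV
    have hsub : V ⊆ g.symm '' E' := fun x hx => ⟨g x, hV ⟨x, hx, rfl⟩, by simp⟩
    refine (h.volume_le _ (isEllipsoid_image g.symm hE') hsub).trans_eq ?_
    have himg : g.symm '' E' = g ⁻¹' E' := by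
      ext x
      constructor
      · rintro ⟨y, hy, rfl⟩
        simpa using hy
      · intro hx
        exact ⟨g x, hx, by simp⟩
    rw [himg]
    exact g.measurePreserving.measure_preimage_equiv (f := g.toHomeomorph.toMeasurableEquiv) E'

/-- The action of `O(n)` on `C(n)`, `g • V = g(V)`. -/
instance SymBody.instMulAction (n : ℕ) : MulAction (On n) (SymBody n) where
  smul := SymBody.map
  one_smul V := SymBody.ext_toSet (image_id V.toSet)
  mul_smul g h V := SymBody.ext_toSet (image_comp g h V.toSet)

/-- The action of `O(n)` on `L(n)`, `g • V = g(V)`. -/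
instance LownerSlice.instMulAction (n : ℕ) : MulAction (On n) (LownerSlice n) where
  smul g V := ⟨g • V.1, isLownerEllipsoid_image g V.2⟩
  one_smul V := Subtype.ext (one_smul (On n) V.1)
  mul_smul g h V := Subtype.ext (mul_smul g h V.1)

/-- The closed unit ball `Bⁿ`, as an element of `C(n)`. -/
def SymBody.unitBall (n : ℕ) : SymBody n :=
  ⟨⟨closedBall 0 1, convex_closedBall _ _, isCompact_closedBall _ _, ⟨0, by simp⟩⟩, by
    constructor
    · intro x hx
      have h : x ∈ closedBall (0 : Rn n) 1 := hx
      change -x ∈ closedBall (0 : Rn n) 1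
      simpa using h
    · exact ⟨0, ball_subset_interior_closedBall (mem_ball_self one_pos)⟩⟩

/-- The closed unit ball `Bⁿ`, as an element of `L(n)`. -/
def LownerSlice.unitBall (n : ℕ) : LownerSlice n :=
  ⟨SymBody.unitBall n, ⟨⟨ContinuousLinearEquiv.refl ℝ _, (image_id _).symm⟩, Subset.rfl,
    fun _ _ h => measure_mono h⟩⟩

end

/-! Put c = t/2 · d, where d is the Hausdorff distance from V to the ball, and deform V to (1 - c)V
+ W. Here W is the convex hull of 0 and the points (t/2 · β(y))y for unit y, where the weight 0 ≤ β
≤ d equals d on V and vanishes far from V.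

A contact point x of V with the sphere stays in the new body, because x = (1 - c)x + cx, and the new
body stays in the ball by the triangle inequality. The Löwner property survives such a change, since
it depends only on contact points (`IsLownerEllipsoid.of_contact_subset`).

If V is not the ball, some unit y has β(y) = 0, so the generators of W miss an open ray. The point
where this ray leaves W is then not extreme, and W has a face containing a segment
(`exists_face_convexHull_of_ray`). A Minkowski sum inherits a translate of that segment in its
boundary (`not_isEllipticallyConvex_add`). Everything is built from distances, which gives
equivariance and an explicit Lipschitz bound. -/

/-! ### Löwner ellipsoids and contact points -/

theorem LinearMap.det_adjoint_real {E : Type*} [NormedAddCommGroup E] [InnerProductSpace ℝ E]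
    [FiniteDimensional ℝ E] (A : E →ₗ[ℝ] E) : LinearMap.det (LinearMap.adjoint A) = LinearMap.det A := by
  let b := stdOrthonormalBasis ℝ E
  rw [← LinearMap.det_toMatrix b.toBasis, LinearMap.toMatrix_adjoint b b,
    Matrix.det_conjTranspose, LinearMap.det_toMatrix]
  simp

/-- The arithmetic-geometric mean inequality for the singular values of a linear map. -/
theorem LinearMap.finrank_lt_trace_adjoint_comp_self {E : Type*} [NormedAddCommGroup E]
    [InnerProductSpace ℝ E] [FiniteDimensional ℝ E] (A : E →ₗ[ℝ] E)
    (hA : 1 < |LinearMap.det A|) :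
    (Module.finrank ℝ E : ℝ) < LinearMap.trace ℝ E (LinearMap.adjoint A ∘ₗ A) := by
  have hP := LinearMap.isPositive_adjoint_comp_self A
  have hS := hP.isSymmetric
  have hdet : LinearMap.det (LinearMap.adjoint A ∘ₗ A) = ∏ i, hS.eigenvalues rfl i :=
    hS.det_eq_prod_eigenvalues rfl
  have htr : LinearMap.trace ℝ E (LinearMap.adjoint A ∘ₗ A) = ∑ i, hS.eigenvalues rfl i := by
    rw [LinearMap.trace_eq_matrix_trace ℝ (hS.eigenvectorBasis rfl).toBasis,
      hS.toMatrix_eigenvectorBasis rfl, Matrix.trace_diagonal]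
    rfl
  have hgt : 1 < ∏ i, hS.eigenvalues rfl i := by
    rw [← hdet, LinearMap.det_comp, LinearMap.det_adjoint_real, ← sq, ← sq_abs]
    nlinarith
  have hne : ∀ i, hS.eigenvalues rfl i ≠ 0 := fun i h => by
    rw [Finset.prod_eq_zero (Finset.mem_univ i) h] at hgt
    linarith
  have hpos : ∀ i, 0 < hS.eigenvalues rfl i := fun i =>
    lt_of_le_of_ne (hP.nonneg_eigenvalues rfl i) (hne i).symm
  -- The inequality log λ ≤ λ - 1 turns "product above 1" into "sum above the number of
  -- eigenvalues".
  have hlog : 0 < ∑ i, Real.log (hS.eigenvalues rfl i) := by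
    rw [← Real.log_prod (fun i _ => hne i)]
    exact Real.log_pos hgt
  have hle : ∑ i, Real.log (hS.eigenvalues rfl i) ≤ ∑ i, (hS.eigenvalues rfl i - 1) :=
    Finset.sum_le_sum fun i _ => Real.log_le_sub_one_of_pos (hpos i)
  rw [Finset.sum_sub_distrib] at hle
  simp only [Finset.sum_const, Finset.card_univ, Fintype.card_fin, nsmul_eq_mul, mul_one] at hle
  rw [htr]
  linarith

-- First-order expansion: det(1 + sN) = 1 + s tr N + s² p(s) with p a polynomial.
open Filter Topology in
theorem LinearMap.eventually_one_lt_det_one_add_smul {E : Type*} [NormedAddCommGroup E]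
    [InnerProductSpace ℝ E] [FiniteDimensional ℝ E] (N : E →ₗ[ℝ] E)
    (hN : 0 < LinearMap.trace ℝ E N) :
    ∀ᶠ s : ℝ in 𝓝[>] 0, 1 < LinearMap.det (1 + s • N) := by
  let b := (stdOrthonormalBasis ℝ E).toBasis
  have hdet : ∀ s : ℝ, LinearMap.det (1 + s • N) =
      (1 + s • LinearMap.toMatrix b b N).det := fun s => by
    rw [← LinearMap.det_toMatrix b, map_add, map_smul, LinearMap.toMatrix_one]
  rw [LinearMap.trace_eq_matrix_trace ℝ b] at hN
  set p := (Matrix.det (1 + (Polynomial.X : Polynomial ℝ) •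
    (LinearMap.toMatrix b b N).map Polynomial.C)).divX.divX
  have hcont : Tendsto (fun s : ℝ => (LinearMap.toMatrix b b N).trace + p.eval s * s)
      (𝓝[>] 0) (𝓝 ((LinearMap.toMatrix b b N).trace + p.eval 0 * 0)) :=
    ((continuous_const.add (p.continuous.mul continuous_id)).tendsto 0).mono_left
      nhdsWithin_le_nhds
  have hev := hcont.eventually (lt_mem_nhds (a := 0) (by simpa using hN))
  filter_upwards [hev, self_mem_nhdsWithin] with s hs hs0
  rw [hdet, Matrix.det_one_add_smul]
  have : 0 < s * ((LinearMap.toMatrix b b N).trace + p.eval s * s) := mul_pos hs0 hs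
  nlinarith

open Filter Topology in
theorem eventually_norm_one_add_smul_le {n : ℕ} {V : Set (Rn n)} (hV : IsCompact V)
    (hsub : V ⊆ closedBall 0 1) (N : Rn n →L[ℝ] Rn n)
    (hN : ∀ x ∈ V, ‖x‖ = 1 → inner ℝ x (N x) < 0) :
    ∀ᶠ s : ℝ in 𝓝[>] 0, ∀ x ∈ V, ‖x + s • N x‖ ≤ 1 := by
  -- By compactness, each point of V is either uniformly inside the ball or moved inward at a
  -- uniform rate. Small s handles both cases through the expansion of the squared norm.
  obtain ⟨δ, hδ, hδV⟩ : ∃ δ > 0, ∀ x ∈ V, δ ≤ max (1 - ‖x‖ ^ 2) (-2 * inner ℝ x (N x)) := by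
    rcases V.eq_empty_or_nonempty with rfl | hne
    · exact ⟨1, one_pos, by simp⟩
    have hc : ContinuousOn (fun x : Rn n => max (1 - ‖x‖ ^ 2) (-2 * inner ℝ x (N x))) V := by
      fun_prop
    obtain ⟨x₀, hx₀, hmin⟩ := hV.exists_isMinOn hne hc
    refine ⟨_, ?_, fun x hx => hmin hx⟩
    have h1 : ‖x₀‖ ≤ 1 := by simpa using hsub hx₀
    rcases h1.lt_or_eq with h | h
    · exact lt_max_of_lt_left (by nlinarith [norm_nonneg x₀])
    · exact lt_max_of_lt_right (by linarith [hN x₀ hx₀ h])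
  have e1 : ∀ᶠ s : ℝ in 𝓝[>] 0, s * (2 * ‖N‖ + s * ‖N‖ ^ 2) < δ := by
    have : Tendsto (fun s : ℝ => s * (2 * ‖N‖ + s * ‖N‖ ^ 2)) (𝓝[>] 0) (𝓝 0) := by
      have h : Continuous (fun s : ℝ => s * (2 * ‖N‖ + s * ‖N‖ ^ 2)) := by fun_prop
      simpa using (h.tendsto 0).mono_left (nhdsWithin_le_nhds (s := Ioi 0))
    exact this.eventually (gt_mem_nhds hδ)
  have e2 : ∀ᶠ s : ℝ in 𝓝[>] 0, s * ‖N‖ ^ 2 < δ := by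
    have : Tendsto (fun s : ℝ => s * ‖N‖ ^ 2) (𝓝[>] 0) (𝓝 0) := by
      have h : Continuous (fun s : ℝ => s * ‖N‖ ^ 2) := by fun_prop
      simpa using (h.tendsto 0).mono_left (nhdsWithin_le_nhds (s := Ioi 0))
    exact this.eventually (gt_mem_nhds hδ)
  filter_upwards [e1, e2, self_mem_nhdsWithin] with s h1 h2 hs x hx
  have hs : 0 < s := hs
  have hx1 : ‖x‖ ≤ 1 := by simpa using hsub hx
  have hNx : ‖N x‖ ≤ ‖N‖ := (N.le_opNorm x).trans (mul_le_of_le_one_right (norm_nonneg _) hx1)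
  have hNx2 : ‖N x‖ ^ 2 ≤ ‖N‖ ^ 2 := pow_le_pow_left₀ (norm_nonneg _) hNx 2
  have hexp : ‖x + s • N x‖ ^ 2 = ‖x‖ ^ 2 + 2 * s * inner ℝ x (N x) + s ^ 2 * ‖N x‖ ^ 2 := by
    rw [norm_add_sq_real, inner_smul_right, norm_smul, Real.norm_of_nonneg hs.le]
    ring
  have hin : inner ℝ x (N x) ≤ ‖N‖ := (real_inner_le_norm _ _).trans (by
    nlinarith [norm_nonneg x, norm_nonneg (N x)])
  have hx2 : ‖x‖ ^ 2 ≤ 1 := pow_le_one₀ (norm_nonneg _) hx1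
  have hsq : s ^ 2 * ‖N x‖ ^ 2 ≤ s ^ 2 * ‖N‖ ^ 2 := by gcongr
  have hle : ‖x + s • N x‖ ^ 2 ≤ 1 := by
    rw [hexp]
    rcases le_max_iff.1 (hδV x hx) with h | h
    · have : s * inner ℝ x (N x) ≤ s * ‖N‖ := by gcongr
      nlinarith
    · have : s * δ ≤ s * (-2 * inner ℝ x (N x)) := by gcongr
      have : s * (s * ‖N‖ ^ 2) ≤ s * δ := by gcongr
      nlinarith
  exact (sq_le_one_iff₀ (norm_nonneg _)).1 hle

theorem volume_closedBall_pos_lt_top (n : ℕ) :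
    0 < volume (closedBall (0 : Rn n) 1) ∧ volume (closedBall (0 : Rn n) 1) < ⊤ :=
  ⟨measure_closedBall_pos volume _ one_pos, measure_closedBall_lt_top⟩

open Filter Topology in
/-- If the unit ball is the Löwner ellipsoid of `V`, then a linear map that does not expand any of
the contact points of `V` with the unit sphere has determinant at most `1` in absolute value. -/
theorem IsLownerEllipsoid.abs_det_le_one {n : ℕ} {V : Set (Rn n)} (hV : IsCompact V)
    (h : IsLownerEllipsoid (closedBall (0 : Rn n) 1) V) (A : Rn n →ₗ[ℝ] Rn n)
    (hA : ∀ x ∈ V, ‖x‖ = 1 → ‖A x‖ ≤ 1) : |LinearMap.det A| ≤ 1 := by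
  by_contra! hdet
  -- Shrinking `A` slightly makes it contract the contact points strictly while its determinant
  -- stays above 1.
  obtain ⟨c, ⟨hc0, hc1⟩, hc⟩ : ∃ c : ℝ, c ∈ Ioo 0 1 ∧ 1 < |LinearMap.det (c • A)| := by
    have hcont : ContinuousAt (fun c : ℝ => |LinearMap.det (c • A)|) 1 := by
      simp only [LinearMap.det_smul]
      fun_prop
    have hev := (hcont.tendsto.mono_left (nhdsWithin_le_nhds (s := Iio 1))).eventually
      (lt_mem_nhds (a := 1) (by simpa using hdet))
    have hIoo : ∀ᶠ c : ℝ in 𝓝[<] 1, c ∈ Ioo (0 : ℝ) 1 := Ioo_mem_nhdsLT one_pos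
    exact (hIoo.and hev).exists
  set A' := c • A
  have hA' : ∀ x ∈ V, ‖x‖ = 1 → ‖A' x‖ < 1 := fun x hx hx1 => by
    have := hA x hx hx1
    simp only [A', LinearMap.smul_apply, norm_smul, Real.norm_of_nonneg hc0.le]
    nlinarith [norm_nonneg (A x)]
  -- The trace of `N` is positive, yet ⟨x, Nx⟩ = ‖A'x‖² - ‖x‖² is negative at contact points. So 1 +
  -- sN raises volume and keeps V in the ball, and its inverse maps the ball to a smaller ellipsoid
  -- around V.
  set N : Rn n →ₗ[ℝ] Rn n := LinearMap.adjoint A' ∘ₗ A' - 1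
  have htr : 0 < LinearMap.trace ℝ (Rn n) N := by
    have := LinearMap.finrank_lt_trace_adjoint_comp_self A' hc
    rw [map_sub, LinearMap.trace_one]
    linarith
  have hN : ∀ x ∈ V, ‖x‖ = 1 → inner ℝ x (LinearMap.toContinuousLinearMap N x) < 0 := by
    intro x hx hx1
    have h1 := hA' x hx hx1
    have : inner ℝ x (N x) = ‖A' x‖ ^ 2 - ‖x‖ ^ 2 := by
      simp only [N, LinearMap.sub_apply, LinearMap.comp_apply, Module.End.one_apply, inner_sub_right,
        LinearMap.adjoint_inner_right, real_inner_self_eq_norm_sq]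
    change inner ℝ x (N x) < 0
    rw [this, hx1]
    nlinarith [norm_nonneg (A' x)]
  obtain ⟨s, hs1, hs2⟩ := ((LinearMap.eventually_one_lt_det_one_add_smul N htr).and
    (eventually_norm_one_add_smul_le hV h.subset _ hN)).exists
  have hne : LinearMap.det (1 + s • N) ≠ 0 := by positivity
  let T := ((1 + s • N).equivOfDetNeZero hne).toContinuousLinearEquiv
  have hT : ∀ x, T x = x + s • N x := fun x => rfl
  have hvol := h.volume_le (T.symm '' closedBall 0 1) ⟨T.symm, rfl⟩ fun x hx =>
    ⟨T x, by simpa [hT] using hs2 x hx, by simp⟩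
  rw [Measure.addHaar_image_continuousLinearEquiv] at hvol
  have hdT : LinearMap.det (T.symm : Rn n →ₗ[ℝ] Rn n) * LinearMap.det (1 + s • N) = 1 := by
    rw [← LinearMap.det_comp]
    convert LinearMap.det_id
    ext1 x
    exact T.symm_apply_apply x
  have hlt : |LinearMap.det (T.symm : Rn n →ₗ[ℝ] Rn n)| < 1 := by
    rw [eq_div_of_mul_eq hne hdT, abs_of_pos (by positivity), div_lt_one (by positivity)]
    exact hs1
  obtain ⟨hp, hf⟩ := volume_closedBall_pos_lt_top n
  refine hvol.not_gt ?_
  calc _ < 1 * volume (closedBall (0 : Rn n) 1) :=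
        ENNReal.mul_lt_mul_left hp.ne' hf.ne (by simpa using hlt)
    _ = _ := one_mul _

/-- The Löwner ellipsoid of a body depends only on its contact points: a subset of the unit ball
that contains all contact points of a compact set whose Löwner ellipsoid is the unit ball has the
same Löwner ellipsoid. -/
theorem IsLownerEllipsoid.of_contact_subset {n : ℕ} {V W : Set (Rn n)} (hV : IsCompact V)
    (h : IsLownerEllipsoid (closedBall (0 : Rn n) 1) V) (hW : W ⊆ closedBall 0 1)
    (hVW : ∀ x ∈ V, ‖x‖ = 1 → x ∈ W) : IsLownerEllipsoid (closedBall (0 : Rn n) 1) W where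
  isEllipsoid := h.isEllipsoid
  subset := hW
  volume_le := by
    rintro _ ⟨T, rfl⟩ hT
    have hdet := h.abs_det_le_one hV (T.symm : Rn n →ₗ[ℝ] Rn n) fun x hx hx1 => by
      obtain ⟨y, hy, rfl⟩ := hT (hVW x hx hx1)
      simpa using hy
    rw [Measure.addHaar_image_continuousLinearEquiv]
    have hdT : LinearMap.det (T : Rn n →ₗ[ℝ] Rn n) *
        LinearMap.det (T.symm : Rn n →ₗ[ℝ] Rn n) = 1 := by
      rw [← LinearMap.det_comp]
      convert LinearMap.det_id
      ext1 x
      exact T.apply_symm_apply x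
    have hge : 1 ≤ |LinearMap.det (T : Rn n →ₗ[ℝ] Rn n)| := by
      have := congrArg abs hdT
      rw [abs_mul, abs_one] at this
      nlinarith [abs_nonneg (LinearMap.det (T : Rn n →ₗ[ℝ] Rn n))]
    calc volume (closedBall (0 : Rn n) 1) = 1 * volume (closedBall (0 : Rn n) 1) := (one_mul _).symm
      _ ≤ _ := by gcongr; simpa using hge

/-- Without contact points the determinant bound would hold vacuously for 2 · id, whose determinant
is 2ⁿ > 1. -/
theorem IsLownerEllipsoid.exists_contact {n : ℕ} (hn : n ≠ 0) {V : Set (Rn n)} (hV : IsCompact V)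
    (h : IsLownerEllipsoid (closedBall (0 : Rn n) 1) V) : ∃ x ∈ V, ‖x‖ = 1 := by
  by_contra! hne
  have := h.abs_det_le_one hV ((2 : ℝ) • LinearMap.id) fun x hx hx1 => absurd hx1 (hne x hx)
  rw [LinearMap.det_smul, LinearMap.det_id, mul_one, finrank_euclideanSpace_fin, abs_pow] at this
  have h2 : (1 : ℝ) < |2| ^ n := one_lt_pow₀ (by norm_num) hn
  linarith

/-! ### Convex hulls, faces and Minkowski sums -/

/-- In finite dimension, the convex hull of a compact set is compact. -/
theorem IsCompact.isCompact_convexHull {E : Type*} [NormedAddCommGroup E] [NormedSpace ℝ E]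
    [FiniteDimensional ℝ E] {s : Set E} (hs : IsCompact s) : IsCompact (convexHull ℝ s) := by
  -- Carathéodory: at most `finrank + 1` points are needed, so the hull is a finite union of
  -- continuous images of compact sets.
  have key : convexHull ℝ s = ⋃ k ∈ Finset.range (Module.finrank ℝ E + 2),
      (fun p : (Fin k → ℝ) × (Fin k → E) => ∑ i, p.1 i • p.2 i) ''
        (stdSimplex ℝ (Fin k) ×ˢ Set.pi univ fun _ => s) := by
    ext x
    simp only [mem_iUnion]
    constructor
    · intro hx
      obtain ⟨ι, _, z, w, hz, hind, hw, hw1, hx⟩ := eq_pos_convex_span_of_mem_convexHull hx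
      refine ⟨Fintype.card ι, ?_, ⟨w ∘ (Fintype.equivFin ι).symm, z ∘ (Fintype.equivFin ι).symm⟩,
        ⟨⟨fun i => (hw _).le, ?_⟩, fun i _ => hz (mem_range_self _)⟩, ?_⟩
      · have := hind.card_le_finrank_succ
        have := Submodule.finrank_le (vectorSpan ℝ (range z))
        rw [Finset.mem_range]
        omega
      · rw [← hw1]
        exact (Fintype.equivFin ι).symm.sum_comp w
      · rw [← hx]
        exact (Fintype.equivFin ι).symm.sum_comp fun i => w i • z i
    · rintro ⟨k, -, ⟨w, z⟩, ⟨hw, hz⟩, rfl⟩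
      exact (convex_convexHull ℝ s).sum_mem (fun i _ => hw.1 i) hw.2
        fun i _ => subset_convexHull ℝ s (hz i (mem_univ i))
  rw [key]
  refine Finset.isCompact_biUnion _ fun k _ => ?_
  exact ((isCompact_stdSimplex ℝ (Fin k)).prod (isCompact_univ_pi fun _ => hs)).image (by fun_prop)

/-- The convex hull of a compact symmetric set that misses an open ray has a face containing a
nontrivial segment. -/
theorem exists_face_convexHull_of_ray {E : Type*} [NormedAddCommGroup E] [NormedSpace ℝ E]
    [FiniteDimensional ℝ E] {Z : Set E} (hZ : IsCompact Z) (hsymm : ∀ z ∈ Z, -z ∈ Z)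
    (h0 : (0 : E) ∈ Z) (hne : ∃ z ∈ Z, z ≠ 0) {y : E} (hy : y ≠ 0)
    (hray : ∀ s : ℝ, 0 < s → s • y ∉ Z) :
    ∃ f : E →L[ℝ] ℝ, f ≠ 0 ∧ ∃ a ∈ convexHull ℝ Z, ∃ b ∈ convexHull ℝ Z, a ≠ b ∧ f b = f a ∧
      ∀ z ∈ convexHull ℝ Z, f z ≤ f a := by
  set W := convexHull ℝ Z
  have hWc : IsCompact W := hZ.isCompact_convexHull
  have hWconv : Convex ℝ W := convex_convexHull ℝ Z
  have hZW : Z ⊆ W := subset_convexHull ℝ Z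
  have hWsymm : ∀ z ∈ W, -z ∈ W := by
    have : -Z = Z := by
      ext z
      exact ⟨fun h => by simpa using hsymm _ h, fun h => hsymm _ h⟩
    intro z hz
    change z ∈ -W
    rwa [← convexHull_neg, this]
  rcases (interior W).eq_empty_or_nonempty with hint | hint
  -- A flat `W` lies in a hyperplane through 0, so all of `W` is a face, and it contains the segment
  -- from 0 to `z`.
  · obtain ⟨z, hz, hz0⟩ := hne
    have hspan : affineSpan ℝ W ≠ ⊤ := fun h => by
      rw [← hWconv.interior_nonempty_iff_affineSpan_eq_top, hint] at h
      exact not_nonempty_empty h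
    have hspan' : Submodule.span ℝ W < ⊤ := by
      refine lt_top_iff_ne_top.2 fun h => hspan ?_
      have hcoe := affineSpan_insert_zero (k := ℝ) W
      rw [insert_eq_of_mem (hZW h0), h] at hcoe
      exact SetLike.coe_injective (by simpa using hcoe)
    obtain ⟨f, hf0, hf⟩ := Submodule.exists_le_ker_of_lt_top _ hspan'
    have hfW : ∀ w ∈ W, f w = 0 := fun w hw => hf (Submodule.subset_span hw)
    refine ⟨LinearMap.toContinuousLinearMap f, by simpa using hf0, 0, hZW h0, z, hZW hz, hz0.symm,
      ?_, fun w hw => ?_⟩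
    · simpa using hfW z (hZW hz)
    · simpa using (hfW w hw).le
  · have hzero : (0 : E) ∈ interior W := by
      obtain ⟨w, hw⟩ := hint
      have hw' : -w ∈ W := hWsymm _ (interior_subset hw)
      have := hWconv.combo_interior_self_mem_interior hw hw' (a := 1 / 2) (b := 1 / 2)
        (by norm_num) (by norm_num) (by norm_num)
      simpa using this
    have hclosed : IsCompact {s : ℝ | s • y ∈ W} := by
      have hemb : Topology.IsClosedEmbedding (fun s : ℝ => s • y) := by
        exact isClosedEmbedding_smul_left hy
      exact hemb.isCompact_preimage hWc
    obtain ⟨s, hs, hmax⟩ := hclosed.exists_isGreatest ⟨0, by simpa using hZW h0⟩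
    have hopen : ∀ r : ℝ, r • y ∈ interior W → ∃ r' > r, r' • y ∈ W := by
      intro r hr
      have hc : Continuous (fun r : ℝ => r • y) := by fun_prop
      have := (hc.continuousAt (x := r)).preimage_mem_nhds (mem_interior_iff_mem_nhds.1 hr)
      obtain ⟨ε, hε, hb⟩ := Metric.mem_nhds_iff.1 this
      exact ⟨r + ε / 2, by linarith, hb (by simp [abs_of_pos hε]; linarith)⟩
    have hs0 : 0 < s := by
      obtain ⟨r, hr, hrW⟩ := hopen 0 (by simpa using hzero)
      exact lt_of_lt_of_le hr (hmax hrW)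
    have hsint : s • y ∉ interior W := fun h => by
      obtain ⟨r, hr, hrW⟩ := hopen s h
      exact hr.not_ge (hmax hrW)
    obtain ⟨f, hf⟩ := geometric_hahn_banach_open_point hWconv.interior isOpen_interior hsint
    have hf0 : f ≠ 0 := by
      rintro rfl
      simpa using hf 0 hzero
    have hfW : ∀ w ∈ W, f w ≤ f (s • y) := by
      intro w hw
      have hwc : w ∈ closure (interior W) := by
        rw [hWconv.closure_interior_eq_closure_of_nonempty_interior hint]
        exact subset_closure hw
      exact closure_minimal (fun x hx => (hf x hx).le) (isClosed_le f.continuous continuous_const) hwc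
    refine ⟨f, hf0, s • y, hs, ?_⟩
    -- If the supporting face at the exit point `s • y` were a single point, that point would be
    -- extreme in the hull, hence would lie in `Z`, against `hray`.
    by_contra! hcon
    have huniq : ∀ b ∈ W, f b = f (s • y) → b = s • y := by
      intro b hb hfb
      by_contra hbs
      obtain ⟨z, hz, hlt⟩ := hcon b hb (Ne.symm hbs) hfb
      exact hlt.not_ge (hfW z hz)
    refine hray s hs0 (extremePoints_convexHull_subset (𝕜 := ℝ) ⟨hs, ?_⟩)
    rintro x₁ hx₁ x₂ hx₂ ⟨a, b, ha, hb, hab, hx⟩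
    refine huniq x₁ hx₁ ?_
    have h1 := hfW x₁ hx₁
    have h2 := hfW x₂ hx₂
    have h3 : a * f x₁ + b * f x₂ = f (s • y) := by
      rw [← hx]; simp
    have h4 : b * f x₂ ≤ b * f (s • y) := by gcongr
    have h5 : a * f (s • y) ≤ a * f x₁ := by
      have : (a + b) * f (s • y) = f (s • y) := by rw [hab, one_mul]
      linarith
    exact le_antisymm h1 (le_of_mul_le_mul_left h5 ha)

open scoped Pointwise in
/-- A Minkowski sum is not elliptically convex if one of the summands has a face that contains a
nontrivial segment. -/
theorem not_isEllipticallyConvex_add {n : ℕ} {A W : Set (Rn n)} (hA : IsCompact A)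
    (hAne : A.Nonempty) (hAc : Convex ℝ A) (hWc : Convex ℝ W) (hint : (interior (A + W)).Nonempty)
    {f : Rn n →L[ℝ] ℝ} (hf : f ≠ 0) {a b : Rn n} (ha : a ∈ W) (hb : b ∈ W) (hab : a ≠ b)
    (hfab : f b = f a) (hmax : ∀ z ∈ W, f z ≤ f a) : ¬ IsEllipticallyConvex (A + W) := by
  intro hell
  -- Adding a maximizer of `f` on `A` moves the segment into the face of the sum where `f` is
  -- maximal; its midpoint `p` is a boundary point that is not extreme.
  obtain ⟨v, hv, hvmax⟩ := hA.exists_isMaxOn hAne f.continuous.continuousOn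
  set p := (1 / 2 : ℝ) • (v + a) + (1 / 2 : ℝ) • (v + b)
  have h1 : v + a ∈ A + W := add_mem_add hv ha
  have h2 : v + b ∈ A + W := add_mem_add hv hb
  have hp : p ∈ A + W := (hAc.add hWc) h1 h2 (by norm_num) (by norm_num) (by norm_num)
  have hfp : ∀ z ∈ A + W, f z ≤ f p := by
    rintro _ ⟨x, hx, w, hw, rfl⟩
    have hx' : f x ≤ f v := hvmax hx
    have := hmax w hw
    simp only [p, map_add, map_smul, smul_eq_mul, hfab]
    linarith
  have hnotint : p ∉ interior (A + W) := by
    intro hpi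
    obtain ⟨u, hu⟩ : ∃ u, 0 < f u := by
      obtain ⟨u, hu⟩ := DFunLike.ne_iff.1 hf
      rcases lt_or_gt_of_ne hu with h | h
      · exact ⟨-u, by simpa using h⟩
      · exact ⟨u, by simpa using h⟩
    have hc : ContinuousAt (fun r : ℝ => p + r • u) 0 := by fun_prop
    have := hc.preimage_mem_nhds (by simpa using mem_interior_iff_mem_nhds.1 hpi)
    obtain ⟨ε, hε, hball⟩ := Metric.mem_nhds_iff.1 this
    have hmem : p + (ε / 2) • u ∈ A + W := hball (by simp [abs_of_pos hε]; linarith)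
    have := hfp _ hmem
    simp only [map_add, map_smul, smul_eq_mul] at this
    nlinarith
  have hpf : p ∈ intrinsicFrontier ℝ (A + W) := by
    rw [← intrinsicClosure_sdiff_intrinsicInterior]
    refine ⟨subset_intrinsicClosure hp, fun hpi => hnotint ?_⟩
    have htop := ((hAc.add hWc).interior_nonempty_iff_affineSpan_eq_top).1 hint
    obtain ⟨q, hq, hqp⟩ := mem_intrinsicInterior.1 hpi
    have hopen : IsOpen (affineSpan ℝ (A + W) : Set (Rn n)) := by
      rw [htop]; exact isOpen_univ
    rw [← hqp]
    exact interior_mono (image_preimage_subset _ _)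
      (hopen.isOpenMap_subtype_val.image_interior_subset _ (mem_image_of_mem _ hq))
  rw [← hell] at hpf
  have heq := hpf.2 h1 h2 ⟨1 / 2, 1 / 2, by norm_num, by norm_num, by norm_num, rfl⟩
  refine hab ?_
  have : (1 / 2 : ℝ) • (a - b) = 0 := by
    have h : v + a - p = 0 := sub_eq_zero.2 heq
    rw [← h]
    simp only [p]
    module
  simpa [sub_eq_zero] using this

/-! ### The weights: distance to the ball and bump function -/

noncomputable section

open scoped Pointwise

namespace LownerSlice

variable {n : ℕ}

theorem toSet_isCompact (V : LownerSlice n) : IsCompact V.toSet := V.1.1.isCompact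

theorem toSet_convex (V : LownerSlice n) : Convex ℝ V.toSet := V.1.1.convex

theorem zero_mem (V : LownerSlice n) : (0 : Rn n) ∈ V.toSet :=
  V.1.1.zero_mem_of_symmetric V.1.2.1

theorem norm_le_one (V : LownerSlice n) {x : Rn n} (hx : x ∈ V.toSet) : ‖x‖ ≤ 1 := by
  simpa using V.2.subset hx

theorem dist_eq_hausdorffDist (V W : LownerSlice n) : dist V W = hausdorffDist V.toSet W.toSet :=
  rfl

theorem hausdorffEDist_ne_top (V W : LownerSlice n) : hausdorffEDist V.toSet W.toSet ≠ ⊤ :=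
  ConvexBody.hausdorffEDist_ne_top

theorem toSet_unitBall : (unitBall n).toSet = closedBall (0 : Rn n) 1 := rfl

theorem toSet_smul (g : On n) (V : LownerSlice n) : (g • V).toSet = g '' V.toSet := rfl

theorem ext_toSet {V W : LownerSlice n} (h : V.toSet = W.toSet) : V = W :=
  Subtype.ext (SymBody.ext_toSet h)

theorem dist_smul_smul (g : On n) (V W : LownerSlice n) : dist (g • V) (g • W) = dist V W :=
  hausdorffDist_image g.isometry

theorem smul_unitBall (g : On n) : g • unitBall n = unitBall n :=
  ext_toSet (by rw [toSet_smul, toSet_unitBall, g.image_closedBall, map_zero])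

theorem infDist_smul (g : On n) (V : LownerSlice n) (y : Rn n) :
    infDist (g y) (g • V).toSet = infDist y V.toSet :=
  infDist_image g.isometry

theorem infDist_neg (V : LownerSlice n) (y : Rn n) : infDist (-y) V.toSet = infDist y V.toSet := by
  have h : V.toSet = (LinearIsometryEquiv.neg ℝ : On n) '' V.toSet := by
    ext x
    constructor
    · exact fun hx => ⟨-x, V.1.2.1 x hx, by simp⟩
    · rintro ⟨z, hz, rfl⟩
      exact V.1.2.1 z hz
  nth_rw 1 [h]
  exact infDist_image (LinearIsometryEquiv.neg ℝ : On n).isometry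

/-- The distance of `V` to the unit ball. -/
def gap (V : LownerSlice n) : ℝ := dist V (unitBall n)

theorem gap_nonneg (V : LownerSlice n) : 0 ≤ V.gap := dist_nonneg

theorem gap_pos {V : LownerSlice n} (hV : V ≠ unitBall n) : 0 < V.gap := by
  refine V.gap_nonneg.lt_of_ne fun h => hV (ext_toSet ?_)
  exact (V.toSet_isCompact.isClosed.hausdorffDist_zero_iff_eq
    (unitBall n).toSet_isCompact.isClosed (hausdorffEDist_ne_top _ _)).1 h.symm

theorem gap_le_one (V : LownerSlice n) : V.gap ≤ 1 := by
  refine hausdorffDist_le_of_mem_dist zero_le_one (fun x hx => ?_) fun x hx => ?_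
  · exact ⟨x, V.2.subset hx, by simp⟩
  · exact ⟨0, V.zero_mem, by simpa using (unitBall n).norm_le_one hx⟩

theorem gap_smul (g : On n) (V : LownerSlice n) : (g • V).gap = V.gap := by
  rw [gap, gap, ← dist_smul_smul g V, smul_unitBall]

theorem abs_gap_sub_gap_le (V W : LownerSlice n) : |V.gap - W.gap| ≤ dist V W :=
  abs_dist_sub_le V W (unitBall n)

theorem abs_infDist_sub_infDist_le (V W : LownerSlice n) (y : Rn n) :
    |infDist y V.toSet - infDist y W.toSet| ≤ dist V W := by
  have h1 := infDist_le_infDist_add_hausdorffDist (x := y) (hausdorffEDist_ne_top V W)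
  have h2 := infDist_le_infDist_add_hausdorffDist (x := y) (hausdorffEDist_ne_top W V)
  rw [← dist_eq_hausdorffDist] at h1 h2
  rw [dist_comm] at h2
  rw [abs_le]
  constructor <;> linarith

/-- A function that equals `V.gap` on `V` and vanishes where the distance to `V` is large. -/
def bump (V : LownerSlice n) (y : Rn n) : ℝ := max 0 (V.gap - 2 * infDist y V.toSet)

theorem bump_nonneg (V : LownerSlice n) (y : Rn n) : 0 ≤ V.bump y := le_max_left _ _

theorem bump_le_gap (V : LownerSlice n) (y : Rn n) : V.bump y ≤ V.gap :=
  max_le V.gap_nonneg (by linarith [infDist_nonneg (x := y) (s := V.toSet)])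

theorem bump_of_mem (V : LownerSlice n) {y : Rn n} (hy : y ∈ V.toSet) : V.bump y = V.gap := by
  rw [bump, infDist_zero_of_mem hy, mul_zero, sub_zero, max_eq_right V.gap_nonneg]

theorem continuous_bump (V : LownerSlice n) : Continuous V.bump :=
  continuous_const.max (continuous_const.sub (continuous_const.mul (continuous_infDist_pt _)))

theorem bump_neg (V : LownerSlice n) (y : Rn n) : V.bump (-y) = V.bump y := by
  rw [bump, infDist_neg, bump]

theorem bump_smul (g : On n) (V : LownerSlice n) (y : Rn n) : (g • V).bump (g y) = V.bump y := by
  rw [bump, infDist_smul, gap_smul, bump]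

theorem abs_bump_sub_bump_le (V W : LownerSlice n) (y : Rn n) :
    |V.bump y - W.bump y| ≤ 3 * dist V W := by
  have h1 := abs_le.1 (abs_gap_sub_gap_le V W)
  have h2 := abs_le.1 (abs_infDist_sub_infDist_le V W y)
  refine (abs_max_sub_max_le_max _ _ _ _).trans (max_le (by simp) ?_)
  rw [abs_le]
  constructor <;> linarith

/-- Some point of the ball is farther than half the gap from V. Pushing it radially to the sphere
does not bring it closer, because V is convex and contains 0. -/
theorem exists_bump_eq_zero {V : LownerSlice n} (hV : V ≠ unitBall n) :
    ∃ y : Rn n, ‖y‖ = 1 ∧ V.bump y = 0 := by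
  have hpos := gap_pos hV
  obtain ⟨x, hx, hxV⟩ : ∃ x : Rn n, ‖x‖ ≤ 1 ∧ V.gap / 2 < infDist x V.toSet := by
    by_contra! h
    have : V.gap ≤ V.gap / 2 := by
      refine hausdorffDist_le_of_infDist (by positivity) (fun x hx => ?_) fun x hx => ?_
      · exact (infDist_zero_of_mem (V.2.subset hx : x ∈ (unitBall n).toSet)).trans_le
          (by positivity)
      · exact h x ((unitBall n).norm_le_one hx)
    linarith
  have hx0 : x ≠ 0 := by
    rintro rfl
    rw [infDist_zero_of_mem V.zero_mem] at hxV
    linarith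
  have hnx : 0 < ‖x‖ := norm_pos_iff.2 hx0
  refine ⟨‖x‖⁻¹ • x, by rw [norm_smul, norm_inv, norm_norm, inv_mul_cancel₀ hnx.ne'], ?_⟩
  obtain ⟨v, hv, hvd⟩ := V.toSet_isCompact.exists_infDist_eq_dist ⟨0, V.zero_mem⟩ (‖x‖⁻¹ • x)
  have hmem : ‖x‖ • v ∈ V.toSet := V.toSet_convex.smul_mem_of_zero_mem V.zero_mem hv ⟨hnx.le, hx⟩
  have hle : infDist x V.toSet ≤ infDist (‖x‖⁻¹ • x) V.toSet := by
    calc infDist x V.toSet ≤ dist x (‖x‖ • v) := infDist_le_dist_of_mem hmem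
      _ = dist (‖x‖ • ‖x‖⁻¹ • x) (‖x‖ • v) := by rw [smul_inv_smul₀ hnx.ne']
      _ = ‖x‖ * dist (‖x‖⁻¹ • x) v := by rw [dist_smul₀, norm_norm]
      _ ≤ dist (‖x‖⁻¹ • x) v := mul_le_of_le_one_left dist_nonneg hx
      _ = _ := hvd.symm
  exact max_eq_left (by linarith)

/-! ### The deformation and its equivariance -/

/-- A star-shaped set of spikes reaching farthest in the directions of the contact points of `V`. -/
def spikes (V : LownerSlice n) (t : ℝ) : Set (Rn n) :=
  -- Inserting 0 puts the origin in the set even when the sphere is empty or the bump never vanishes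
  -- on it.
  (fun y => (t / 2 * V.bump y) • y) '' insert 0 (sphere 0 1)

theorem isCompact_spikes (V : LownerSlice n) (t : ℝ) : IsCompact (V.spikes t) := by
  have := V.continuous_bump
  exact ((isCompact_sphere 0 1).insert 0).image (by fun_prop)

theorem zero_mem_spikes (V : LownerSlice n) (t : ℝ) : (0 : Rn n) ∈ V.spikes t :=
  ⟨0, mem_insert _ _, smul_zero _⟩

theorem neg_mem_spikes (V : LownerSlice n) (t : ℝ) {z : Rn n} (hz : z ∈ V.spikes t) :
    -z ∈ V.spikes t := by
  obtain ⟨y, hy, rfl⟩ := hz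
  refine ⟨-y, ?_, by simp [bump_neg]⟩
  simpa using hy

/-- The underlying set of the deformation of `V` at time `t`. -/
def deformSet (V : LownerSlice n) (t : ℝ) : Set (Rn n) :=
  convexHull ℝ ((1 - t / 2 * V.gap) • V.toSet + V.spikes t)

theorem deformSet_eq_add (V : LownerSlice n) (t : ℝ) :
    V.deformSet t = (1 - t / 2 * V.gap) • V.toSet + convexHull ℝ (V.spikes t) := by
  rw [deformSet, convexHull_add, (V.toSet_convex.smul _).convexHull_eq]

theorem isCompact_deformSet (V : LownerSlice n) (t : ℝ) : IsCompact (V.deformSet t) :=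
  ((V.toSet_isCompact.smul _).add (V.isCompact_spikes t)).isCompact_convexHull

/-- The factor 1/2 keeps the weight of V at least 1/2, so the scaled copy of V retains interior even
at t = 1. -/
theorem coeff_mem_Icc (V : LownerSlice n) {t : ℝ} (ht : t ∈ Icc (0 : ℝ) 1) :
    t / 2 * V.gap ∈ Icc (0 : ℝ) (1 / 2) := by
  have h0 := V.gap_nonneg
  have h1 := V.gap_le_one
  have := ht.1
  have := ht.2
  constructor
  · positivity
  · nlinarith

theorem norm_spike_le (V : LownerSlice n) {t : ℝ} (ht : t ∈ Icc (0 : ℝ) 1) {y : Rn n}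
    (hy : ‖y‖ ≤ 1) : ‖(t / 2 * V.bump y) • y‖ ≤ t / 2 * V.gap := by
  have h0 := V.bump_nonneg y
  have h1 := V.bump_le_gap y
  have := ht.1
  rw [norm_smul, Real.norm_of_nonneg (by positivity)]
  calc t / 2 * V.bump y * ‖y‖ ≤ t / 2 * V.bump y := mul_le_of_le_one_right (by positivity) hy
    _ ≤ _ := by gcongr

theorem norm_le_one_of_mem_insert {y : Rn n} (hy : y ∈ insert 0 (sphere (0 : Rn n) 1)) :
    ‖y‖ ≤ 1 := by
  rcases hy with rfl | hy
  · simp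
  · exact (mem_sphere_zero_iff_norm.1 hy).le

theorem deformSet_subset (V : LownerSlice n) {t : ℝ} (ht : t ∈ Icc (0 : ℝ) 1) :
    V.deformSet t ⊆ closedBall 0 1 := by
  refine convexHull_min ?_ (convex_closedBall _ _)
  rintro _ ⟨_, ⟨v, hv, rfl⟩, _, ⟨y, hy, rfl⟩, rfl⟩
  obtain ⟨h0, h1⟩ := V.coeff_mem_Icc ht
  rw [mem_closedBall_zero_iff]
  refine (norm_add_le _ _).trans ?_
  have h2 := V.norm_spike_le ht (norm_le_one_of_mem_insert hy)
  have h3 : ‖(1 - t / 2 * V.gap) • v‖ ≤ 1 - t / 2 * V.gap := by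
    rw [norm_smul, Real.norm_of_nonneg (by linarith)]
    exact mul_le_of_le_one_right (by linarith) (V.norm_le_one hv)
  change ‖(1 - t / 2 * V.gap) • v‖ + ‖(t / 2 * V.bump y) • y‖ ≤ 1
  linarith

theorem contact_mem_deformSet (V : LownerSlice n) (t : ℝ) {x : Rn n} (hx : x ∈ V.toSet)
    (hx1 : ‖x‖ = 1) : x ∈ V.deformSet t := by
  refine subset_convexHull ℝ _ ⟨(1 - t / 2 * V.gap) • x, smul_mem_smul_set hx,
    (t / 2 * V.bump x) • x, ⟨x, Or.inr (by simpa using hx1), rfl⟩, ?_⟩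
  change (1 - t / 2 * V.gap) • x + (t / 2 * V.bump x) • x = x
  rw [V.bump_of_mem hx, ← add_smul, sub_add_cancel, one_smul]

theorem neg_mem_deformSet (V : LownerSlice n) (t : ℝ) {x : Rn n} (hx : x ∈ V.deformSet t) :
    -x ∈ V.deformSet t := by
  refine convexHull_min (t := {x | -x ∈ V.deformSet t}) ?_ ?_ hx
  · rintro _ ⟨_, ⟨v, hv, rfl⟩, z, hz, rfl⟩
    refine subset_convexHull ℝ _ ⟨_, smul_mem_smul_set (V.1.2.1 v hv), _, V.neg_mem_spikes t hz, ?_⟩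
    simp [add_comm]
  · exact (convex_convexHull ℝ _).is_linear_preimage (LinearEquiv.neg ℝ).toLinearMap.isLinear

theorem interior_deformSet_nonempty (V : LownerSlice n) {t : ℝ} (ht : t ∈ Icc (0 : ℝ) 1) :
    (interior (V.deformSet t)).Nonempty := by
  obtain ⟨h0, h1⟩ := V.coeff_mem_Icc ht
  have hne : (1 - t / 2 * V.gap) ≠ 0 := by linarith
  have hsub : (1 - t / 2 * V.gap) • V.toSet ⊆ V.deformSet t := by
    refine Subset.trans ?_ (subset_convexHull ℝ _)
    exact fun x hx => ⟨x, hx, 0, V.zero_mem_spikes t, add_zero x⟩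
  refine Nonempty.mono (interior_mono hsub) ?_
  rw [interior_smul₀ hne]
  exact V.1.2.2.smul_set

/-- The deformation of `V` at time `t`. -/
def deform (V : LownerSlice n) (t : unitInterval) : LownerSlice n :=
  ⟨⟨⟨V.deformSet t, convex_convexHull ℝ _, V.isCompact_deformSet t,
    (V.interior_deformSet_nonempty t.2).mono interior_subset⟩,
    fun _ hx => V.neg_mem_deformSet t hx, V.interior_deformSet_nonempty t.2⟩,
    V.2.of_contact_subset V.toSet_isCompact (V.deformSet_subset t.2)
      fun _ hx hx1 => V.contact_mem_deformSet t hx hx1⟩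

theorem toSet_deform (V : LownerSlice n) (t : unitInterval) :
    (V.deform t).toSet = V.deformSet t := rfl

theorem deform_zero (V : LownerSlice n) : V.deform 0 = V := by
  refine ext_toSet ?_
  have h : V.spikes 0 = {0} := by
    have : (fun y => ((0 : ℝ) / 2 * V.bump y) • y) = fun _ : Rn n => (0 : Rn n) := by
      funext y; simp
    rw [spikes, this]
    exact (insert_nonempty _ _).image_const 0
  rw [toSet_deform, Set.Icc.coe_zero, deformSet_eq_add, h]
  simp

theorem spikes_smul (g : On n) (V : LownerSlice n) (t : ℝ) :
    (g • V).spikes t = g '' V.spikes t := by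
  have hS : insert 0 (sphere (0 : Rn n) 1) = g '' insert 0 (sphere (0 : Rn n) 1) := by
    rw [image_insert_eq, g.image_sphere, map_zero]
  rw [spikes, hS, image_image, spikes, image_image]
  refine image_congr fun y _ => ?_
  rw [bump_smul, map_smul]

theorem deform_smul (g : On n) (V : LownerSlice n) (t : unitInterval) :
    (g • V).deform t = g • V.deform t := by
  refine ext_toSet ?_
  rw [toSet_smul, toSet_deform, toSet_deform, deformSet, deformSet, gap_smul, spikes_smul,
    toSet_smul]
  have h1 := (g.toLinearEquiv.toLinearMap).image_convexHull
    ((1 - (t : ℝ) / 2 * V.gap) • V.toSet + V.spikes t)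
  refine Eq.trans ?_ h1.symm
  rw [image_add, image_smul_set]
  rfl

/-! ### Joint continuity -/

/-- Both spikes use the same direction `y`, so only coefficients vary. With d = `dist V W`, the gap
term, v - w and the bump term contribute (|s - t| + d)/2, d and (|s - t| + 3d)/2. -/
theorem dist_deform_point_le (V W : LownerSlice n) {s t : ℝ} (ht : t ∈ Icc (0 : ℝ) 1)
    {v w y : Rn n} (hv : ‖v‖ ≤ 1) (hvw : dist v w ≤ dist V W)
    (hy : ‖y‖ ≤ 1) :
    dist ((1 - s / 2 * V.gap) • v + (s / 2 * V.bump y) • y)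
      ((1 - t / 2 * W.gap) • w + (t / 2 * W.bump y) • y) ≤ |s - t| + 3 * dist V W := by
  obtain ⟨h0, h1⟩ := W.coeff_mem_Icc ht
  have key : ∀ a b d : ℝ, 0 ≤ a → a ≤ 1 → |a - b| ≤ d →
      |s / 2 * a - t / 2 * b| ≤ 1 / 2 * (|s - t| + d) := by
    intro a b d ha0 ha1 hab
    have : s / 2 * a - t / 2 * b = 1 / 2 * ((s - t) * a + t * (a - b)) := by ring
    rw [this, abs_mul, abs_of_pos (by norm_num : (0 : ℝ) < 1 / 2)]
    gcongr
    refine (abs_add_le _ _).trans ?_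
    rw [abs_mul, abs_mul, abs_of_nonneg ha0, abs_of_nonneg ht.1]
    gcongr
    · exact mul_le_of_le_one_right (abs_nonneg _) ha1
    · exact (mul_le_of_le_one_left (abs_nonneg _) ht.2).trans hab
  have hgap := key _ _ _ V.gap_nonneg V.gap_le_one (abs_gap_sub_gap_le V W)
  have hbump := key _ _ _ (V.bump_nonneg y) ((V.bump_le_gap y).trans V.gap_le_one)
    (abs_bump_sub_bump_le V W y)
  have heq : ((1 - s / 2 * V.gap) • v + (s / 2 * V.bump y) • y) -
      ((1 - t / 2 * W.gap) • w + (t / 2 * W.bump y) • y) =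
      (-(s / 2 * V.gap - t / 2 * W.gap)) • v + (1 - t / 2 * W.gap) • (v - w) +
        (s / 2 * V.bump y - t / 2 * W.bump y) • y := by
    module
  rw [dist_eq_norm, heq]
  refine (norm_add₃_le).trans ?_
  rw [norm_smul, norm_smul, norm_smul, norm_neg, Real.norm_eq_abs, Real.norm_eq_abs,
    Real.norm_eq_abs, abs_of_nonneg (by linarith : 0 ≤ 1 - t / 2 * W.gap), ← dist_eq_norm]
  have e1 := mul_le_of_le_one_right (abs_nonneg (s / 2 * V.gap - t / 2 * W.gap)) hv
  have e2 := mul_le_of_le_one_right (abs_nonneg (s / 2 * V.bump y - t / 2 * W.bump y)) hy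
  have e3 := mul_le_of_le_one_left (dist_nonneg (x := v) (y := w))
    (by linarith : 1 - t / 2 * W.gap ≤ 1)
  linarith

theorem exists_dist_le (V W : LownerSlice n) {v : Rn n} (hv : v ∈ V.toSet) :
    ∃ w ∈ W.toSet, dist v w ≤ dist V W := by
  obtain ⟨w, hw, hd⟩ := W.toSet_isCompact.exists_infDist_eq_dist ⟨0, W.zero_mem⟩ v
  exact ⟨w, hw, hd ▸ infDist_le_hausdorffDist_of_mem hv (hausdorffEDist_ne_top V W)⟩

theorem exists_mem_deformSet_dist_le (V W : LownerSlice n) {s t : ℝ} (ht : t ∈ Icc (0 : ℝ) 1)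
    {x : Rn n} (hx : x ∈ V.deformSet s) :
    ∃ y ∈ W.deformSet t, dist x y ≤ |s - t| + 3 * dist V W := by
  have hε : 0 ≤ |s - t| + 3 * dist V W := by positivity
  -- A closed thickening of a convex set is convex, so it suffices to check generators of the hull.
  have hsub : V.deformSet s ⊆ cthickening (|s - t| + 3 * dist V W) (W.deformSet t) := by
    refine convexHull_min ?_ ((convex_convexHull ℝ _).cthickening _)
    rintro _ ⟨_, ⟨v, hv, rfl⟩, _, ⟨y, hy, rfl⟩, rfl⟩
    obtain ⟨w, hw, hvw⟩ := exists_dist_le V W hv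
    refine mem_cthickening_of_dist_le _ _ _ _ (subset_convexHull ℝ _
      (add_mem_add (smul_mem_smul_set hw) (mem_image_of_mem _ hy))) ?_
    exact dist_deform_point_le V W ht (V.norm_le_one hv) hvw (norm_le_one_of_mem_insert hy)
  have := hsub hx
  rw [(W.isCompact_deformSet t).cthickening_eq_biUnion_closedBall hε] at this
  simpa using this

theorem dist_deform_deform_le (V W : LownerSlice n) (s t : unitInterval) :
    dist (V.deform s) (W.deform t) ≤ dist s t + 3 * dist V W := by
  refine hausdorffDist_le_of_mem_dist (by positivity) (fun x hx => ?_) fun x hx => ?_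
  · exact exists_mem_deformSet_dist_le V W t.2 hx
  · rw [dist_comm s t, dist_comm V W]
    exact exists_mem_deformSet_dist_le W V s.2 hx

theorem continuous_deform :
    Continuous fun p : LownerSlice n × unitInterval => p.1.deform p.2 := by
  refine (LipschitzWith.of_dist_le_mul (K := 4) fun p q => ?_).continuous
  have h1 := dist_deform_deform_le p.1 q.1 p.2 q.2
  have h2 : dist p.1 q.1 ≤ dist p q := le_max_left _ _
  have h3 : dist p.2 q.2 ≤ dist p q := le_max_right _ _
  calc _ ≤ _ := h1
    _ ≤ 4 * dist p q := by linarith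

/-! ### Failure of elliptic convexity -/

theorem not_isEllipticallyConvex_deform {V : LownerSlice n} (hV : V ≠ unitBall n)
    {t : unitInterval} (ht : 0 < t) : ¬ IsEllipticallyConvex (V.deform t).toSet := by
  have ht' : (0 : ℝ) < t := ht
  obtain ⟨y, hy1, hy⟩ := exists_bump_eq_zero hV
  have hy0 : y ≠ 0 := by
    rintro rfl
    simp at hy1
  have hn : n ≠ 0 := by
    rintro rfl
    exact hy0 (Subsingleton.elim _ _)
  obtain ⟨k, hk, hk1⟩ := V.2.exists_contact hn V.toSet_isCompact
  have hspike : ∃ z ∈ V.spikes t, z ≠ 0 := by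
    refine ⟨_, ⟨k, Or.inr (by simpa using hk1), rfl⟩, ?_⟩
    have hk0 : k ≠ 0 := by
      rintro rfl
      simp at hk1
    have := gap_pos hV
    change (t / 2 * V.bump k) • k ≠ 0
    rw [V.bump_of_mem hk]
    exact smul_ne_zero (by positivity) hk0
  -- Comparing norms, a spike on the open ray through `y` must come from `y` itself, where the bump
  -- is zero.
  have hray : ∀ s : ℝ, 0 < s → s • y ∉ V.spikes t := by
    rintro s hs ⟨x, hx, hxy⟩
    change (t / 2 * V.bump x) • x = s • y at hxy
    have hsy : s • y ≠ 0 := smul_ne_zero hs.ne' hy0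
    rcases hx with rfl | hx
    · exact hsy (by rw [← hxy, smul_zero])
    have hx1 : ‖x‖ = 1 := by simpa using hx
    have hnorm := congrArg norm hxy
    have hb := V.bump_nonneg x
    rw [norm_smul, norm_smul, hx1, hy1, mul_one, mul_one, Real.norm_of_nonneg (by positivity),
      Real.norm_of_nonneg hs.le] at hnorm
    rw [hnorm] at hxy
    obtain rfl : x = y := smul_right_injective _ hs.ne' hxy
    rw [hy, mul_zero] at hnorm
    exact hs.ne hnorm
  obtain ⟨f, hf, a, ha, b, hb, hab, hfab, hmax⟩ := exists_face_convexHull_of_ray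
    (V.isCompact_spikes t) (fun _ => V.neg_mem_spikes t) (V.zero_mem_spikes t) hspike hy0 hray
  have hint := V.interior_deformSet_nonempty t.2
  rw [toSet_deform]
  rw [deformSet_eq_add] at hint ⊢
  exact not_isEllipticallyConvex_add (V.toSet_isCompact.smul _)
    ⟨_, smul_mem_smul_set V.zero_mem⟩ (V.toSet_convex.smul _) (convex_convexHull ℝ _) hint hf
    ha hb hab hfab hmax

end LownerSlice

end

theorem theorem3p3 (n : ℕ) :
    ∃ F : C(LownerSlice n × unitInterval, LownerSlice n),
      (∀ (g : On n) (V : LownerSlice n) (t : unitInterval), F (g • V, t) = g • F (V, t)) ∧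
      (∀ V : LownerSlice n, F (V, 0) = V) ∧
      (∀ (V : LownerSlice n) (t : unitInterval), V ≠ LownerSlice.unitBall n → 0 < t →
        ¬ IsEllipticallyConvex (F (V, t)).toSet) :=
  ⟨⟨fun p => p.1.deform p.2, LownerSlice.continuous_deform⟩,
    fun g V t => LownerSlice.deform_smul g V t, LownerSlice.deform_zero,
    fun _ _ hV ht => LownerSlice.not_isEllipticallyConvex_deform hV ht⟩
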